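/- Let $1\le N<M$, $D_f>0$, $\sigma>0$, and let $f_1,\dots,f_M\in\mathbb{R}^N$ be fingerprints of equal energy $\|f_m\|^2=\gamma^2:=ND_f$ such that the normalized vectors $f_m/\gamma$ form an equiangular tight frame: they are the (unit-norm) columns of an $N\times M$ matrix whose rows are orthogonal and of equal norm, and the inner products of distinct columns have equal magnitude. Let $\mu:=\max_{i\ne j}|\langle f_i,f_j\rangle|/\gamma^2$ be the worst-case coherence, and let $1\le K<M$. A coalition $\mathcal K\subset\{1,\dots,M\}$ with $|\mathcal K|=K$ produces $z=\frac1K\sum_{k\in\mathcal K}f_k+\epsilon$, where $\epsilon$ is Gaussian on $\mathbb{R}^N$ with mean $0$ and covariance $\sigma^2 I$. User $m$ is declared guilty if $T_m(z):=\langle z,f_m\rangle/\gamma^2\ge\tau$ and innocent otherwise. Put $$\mathrm P_{\mathrm I}(\tau):=\max_{|\mathcal K|=K}\max_{m\notin\mathcal K}\mathrm{Prob}[T_m(z)\ge\tau],\qquad \mathrm P_{\mathrm{II}}(\tau):=\max_{|\mathcal K|=K}\min_{m\in\mathcal K}\mathrm{Prob}[T_m(z)<\tau],$$ $$\mathrm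 P_{\mathrm e}(\tau):=\max\{\mathrm P_{\mathrm I}(\tau),\mathrm P_{\mathrm{II}}(\tau)\},\qquad \mathrm P_{\mathrm{minmax}}:=\min_{\tau\in\mathbb R}\mathrm P_{\mathrm e}(\tau),$$ and let $Q(x):=\frac1{\sqrt{2\pi}}\int_x^\infty e^{-u^2/2}\,du$. Then $\mu=\sqrt{\frac{M-N}{N(M-1)}}$, the minimum over $\tau$ is attained, and the following hold. (1) If $K\ge2$ and $2K\le M$, then $Q(d^*_{\mathrm{low}}/2)\le \mathrm P_{\mathrm{minmax}}$, where $d^*_{\mathrm{low}}:=\sqrt{\frac{M}{M-1}}\,\frac{\sqrt{ND_f}}{\sigma\sqrt{K(K-1)}}$. (For $K=1$ one reads $d^*_{\mathrm{low}}=\infty$, $Q(\infty)=0$, and the bound is trivial.) (2) $\mathrm P_{\mathrm{minmax}}\le Q(d^*_{\mathrm{up}}/2)$, where $d^*_{\mathrm{up}}:=\frac{\sqrt{ND_f}}{\sigma K}\bigl(1-(2K-1)\mu\bigr)$; moreover the threshold $\tau^*:=\frac{1+\mu}{2K}$ already satisfies $\mathrm P_{\mathrm e}(\tau^*)\le Q(d^*_{\mathrm{up}}/2)$.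 -/

import Mathlib

open MeasureTheory ProbabilityTheory

namespace Fingerprint

noncomputable section

/-- The Gaussian tail function `Q(x) = (1/√(2π)) ∫_x^∞ exp(-u²/2) du`. -/
def Q (x : ℝ) : ℝ :=
  (1 / Real.sqrt (2 * Real.pi)) * ∫ u in Set.Ioi x, Real.exp (-u ^ 2 / 2)

/-- The vectors `φ₁, …, φ_M` in `ℝᴺ` (the columns of an `N × M` matrix) form an equiangular tight
frame: the columns have unit norm, the rows are orthogonal and of equal norm, and the inner products
of distinct columns have equal magnitude. -/
structure IsETF {N M : ℕ} (φ : Fin M → EuclideanSpace ℝ (Fin N)) : Prop where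
  unit_columns : ∀ m, ‖φ m‖ = 1
  orthogonal_rows : ∀ i j, i ≠ j → ∑ m, φ m i * φ m j = 0
  equal_norm_rows : ∃ A : ℝ, ∀ i, ∑ m, φ m i ^ 2 = A
  equiangular : ∃ c : ℝ, ∀ m n, m ≠ n → |inner ℝ (φ m) (φ n)| = c

/-- The worst-case coherence of the normalized fingerprints,
`max_{i ≠ j} |⟪f_i, f_j⟫| / (‖f_i‖ ‖f_j‖)`. -/
def coherence {N M : ℕ} (f : Fin M → EuclideanSpace ℝ (Fin N)) : ℝ :=
  ⨆ p : {p : Fin M × Fin M // p.1 ≠ p.2},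
    |inner ℝ (f p.1.1) (f p.1.2)| / (‖f p.1.1‖ * ‖f p.1.2‖)

/-- The law of the noise `ε`: a centred Gaussian vector in `ℝᴺ` with covariance `σ² I`. -/
def noise (N : ℕ) (σ : ℝ) : Measure (EuclideanSpace ℝ (Fin N)) :=
  multivariateGaussian 0 (σ ^ 2 • (1 : Matrix (Fin N) (Fin N) ℝ))

/-- The forgery with the host signal removed, `z = ∑_{k ∈ S} α_k f_k + ε`. -/
def forgery {N M : ℕ} (f : Fin M → EuclideanSpace ℝ (Fin N)) (S : Finset (Fin M))
    (α : Fin M → ℝ) (ε : EuclideanSpace ℝ (Fin N)) : EuclideanSpace ℝ (Fin N) :=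
  ∑ k ∈ S, α k • f k + ε

/-- The test statistic of user `m`, `T_m(z) = ⟪z, f_m⟫ / ‖f_m‖²`. User `m` is declared guilty iff
`T_m(z) ≥ τ`. -/
def testStat {N M : ℕ} (f : Fin M → EuclideanSpace ℝ (Fin N)) (m : Fin M)
    (z : EuclideanSpace ℝ (Fin N)) : ℝ :=
  inner ℝ z (f m) / ‖f m‖ ^ 2

/-- The probability that user `m` is declared guilty when the coalition is `S`; for `m ∉ S` this is
the type I error probability of `m`. -/
def probI {N M : ℕ} (f : Fin M → EuclideanSpace ℝ (Fin N)) (σ : ℝ) (m : Fin M) (τ : ℝ)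
    (S : Finset (Fin M)) (α : Fin M → ℝ) : ℝ :=
  (noise N σ).real {ε | τ ≤ testStat f m (forgery f S α ε)}

/-- The probability that user `m` is declared innocent when the coalition is `S`; for `m ∈ S` this
is the type II error probability of `m`. -/
def probII {N M : ℕ} (f : Fin M → EuclideanSpace ℝ (Fin N)) (σ : ℝ) (m : Fin M) (τ : ℝ)
    (S : Finset (Fin M)) (α : Fin M → ℝ) : ℝ :=
  (noise N σ).real {ε | testStat f m (forgery f S α ε) < τ}

/-- The false alarm probability: the maximum of the type I error over `m ∉ S`. -/
def probFalseAlarm {N M : ℕ} (f : Fin M → EuclideanSpace ℝ (Fin N)) (σ τ : ℝ)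
    (S : Finset (Fin M)) (α : Fin M → ℝ) : ℝ :=
  ⨆ m : {m : Fin M // m ∉ S}, probI f σ m.1 τ S α

/-- The miss probability: the minimum of the type II error over `m ∈ S`. -/
def probMiss {N M : ℕ} (f : Fin M → EuclideanSpace ℝ (Fin N)) (σ τ : ℝ)
    (S : Finset (Fin M)) (α : Fin M → ℝ) : ℝ :=
  ⨅ m : {m : Fin M // m ∈ S}, probII f σ m.1 τ S α

/-- The uniform weights `α_k = 1 / K`. -/
def uniformWeight (M K : ℕ) : Fin M → ℝ := fun _ => 1 / (K : ℝ)

/-- The worst-case type I error probability over coalitions of size `K`, uniform weights. -/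
def worstI {N M : ℕ} (f : Fin M → EuclideanSpace ℝ (Fin N)) (σ : ℝ) (K : ℕ) (τ : ℝ) : ℝ :=
  ⨆ S : {S : Finset (Fin M) // S.card = K}, probFalseAlarm f σ τ S.1 (uniformWeight M K)

/-- The worst-case type II error probability over coalitions of size `K`, uniform weights. -/
def worstII {N M : ℕ} (f : Fin M → EuclideanSpace ℝ (Fin N)) (σ : ℝ) (K : ℕ) (τ : ℝ) : ℝ :=
  ⨆ S : {S : Finset (Fin M) // S.card = K}, probMiss f σ τ S.1 (uniformWeight M K)

/-- The worst-case error probability at threshold `τ`. -/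
def worstError {N M : ℕ} (f : Fin M → EuclideanSpace ℝ (Fin N)) (σ : ℝ) (K : ℕ) (τ : ℝ) : ℝ :=
  max (worstI f σ K τ) (worstII f σ K τ)

/-- The minmax error probability, `min_τ worstError τ`. -/
def minmaxError {N M : ℕ} (f : Fin M → EuclideanSpace ℝ (Fin N)) (σ : ℝ) (K : ℕ) : ℝ :=
  ⨅ τ : ℝ, worstError f σ K τ

/-- `d*_low = √(M/(M-1)) √(N D_f) / (σ √(K(K-1)))`, for `M ≥ 2` and `K ≥ 2`. -/
def dLow (N M K : ℕ) (Df σ : ℝ) : ℝ :=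
  Real.sqrt ((M : ℝ) / ((M : ℝ) - 1)) * Real.sqrt ((N : ℝ) * Df) /
    (σ * Real.sqrt ((K : ℝ) * ((K : ℝ) - 1)))

/-- `d*_up = (√(N D_f) / (σ K)) (1 - (2K - 1) μ)`. -/
def dUp (N K : ℕ) (Df σ μ : ℝ) : ℝ :=
  Real.sqrt ((N : ℝ) * Df) / (σ * (K : ℝ)) * (1 - (2 * (K : ℝ) - 1) * μ)

end

end Fingerprint

/-! Each test statistic is Gaussian with deviation `σ / γ`, where `γ = √(N D_f)`, so only its mean,
a column sum of the normalized Gram matrix over the coalition divided by `K`, matters. With `a` the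
largest mean of an innocent user and `b` the smallest over coalitions of the largest mean of a
member, the two worst errors are `Q ((τ - a) * (γ / σ))` and `Q ((b - τ) * (γ / σ))`. Monotonicity
of `Q` makes the midpoint of `a` and `b` optimal, and everything reduces to bounding `b - a`.

The upper bound on the error uses only that off-diagonal Gram entries lie in `[-μ, μ]`. The lower
bound rests on `guilty_sub_innocent_le`, which gives `K (b - a) ≤ M / (M - 1)`: a coalition is
chosen so that its members can be exchanged for positively correlated outsiders, and when no such
exchange exists the signs of the Gram matrix are rigid enough to compute with. -/

namespace Fingerprint

/-! ### Combinatorics of the signs of an equiangular Gram matrix. -/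

section Combinatorics

variable {V : Type*} [Fintype V] [DecidableEq V]

/-- In a graph on at least `2 K` vertices there are `K` vertices each of which is isolated or has a
neighbour outside the chosen set. -/
lemma exists_card_eq_forall_exists_adj_notMem (G : SimpleGraph V) {K : ℕ}
    (hK : 2 * K ≤ Fintype.card V) :
    ∃ S : Finset V, S.card = K ∧
      ∀ m ∈ S, (∃ j, j ∉ S ∧ G.Adj m j) ∨ ∀ j, ¬ G.Adj m j := by
  -- A maximal independent set: every vertex outside `A` has a neighbour in it. One of `A` and its
  -- complement has at least `K` elements, and any `K` of those will do.
  obtain ⟨A, -, hA⟩ := Finite.exists_le_maximal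
    (p := fun A : Finset V => ∀ i ∈ A, ∀ j ∈ A, ¬ G.Adj i j) (a := ∅) (by simp)
  have hout : ∀ m, m ∉ A → ∃ j ∈ A, G.Adj m j := by
    intro m hm
    by_contra! h
    have hmem : m ∈ A := by
      refine hA.le_of_ge (y := insert m A) ?_ (Finset.subset_insert m A)
        (Finset.mem_insert_self m A)
      intro i hi j hj
      rcases Finset.mem_insert.1 hi with rfl | hiA <;>
        rcases Finset.mem_insert.1 hj with rfl | hjA
      · exact G.loopless.irrefl _
      · exact h j hjA
      · exact fun hadj => h i hiA hadj.symm
      · exact hA.prop i hiA j hjA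
    exact hm hmem
  by_cases hcard : K ≤ A.card
  · obtain ⟨S, hSA, hS⟩ := Finset.exists_subset_card_eq hcard
    refine ⟨S, hS, fun m hm => ?_⟩
    by_cases h : ∃ j, G.Adj m j
    · obtain ⟨j, hj⟩ := h
      exact Or.inl ⟨j, fun hjS => hA.prop m (hSA hm) j (hSA hjS) hj, hj⟩
    · exact Or.inr (not_exists.1 h)
  · have hcard' : K ≤ Aᶜ.card := by rw [Finset.card_compl]; omega
    obtain ⟨S, hSA, hS⟩ := Finset.exists_subset_card_eq hcard'
    refine ⟨S, hS, fun m hm => Or.inl ?_⟩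
    obtain ⟨j, hjA, hj⟩ := hout m (Finset.mem_compl.1 (hSA hm))
    exact ⟨j, fun hjS => Finset.mem_compl.1 (hSA hjS) hjA, hj⟩

/-- For a Gram matrix of equiangular unit vectors, the largest column sum over `K` rows
guaranteed inside a `K`-set exceeds the largest one attainable outside by at most
`|V| / (|V| - 1)`. -/
lemma guilty_sub_innocent_le {g : V → V → ℝ} {c a b : ℝ} {K : ℕ}
    (hsymm : ∀ i j, g i j = g j i) (hdiag : ∀ i, g i i = 1)
    (hoff : ∀ i j, i ≠ j → |g i j| = c) (hpos : 0 ≤ ∑ i, ∑ j, g i j)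
    (hK : 1 ≤ K) (hKV : 2 * K ≤ Fintype.card V)
    (ha : ∀ S : Finset V, S.card = K → ∀ m, m ∉ S → ∑ k ∈ S, g k m ≤ a)
    (hb : ∀ S : Finset V, S.card = K → ∃ m ∈ S, b ≤ ∑ k ∈ S, g k m) :
    b - a ≤ (Fintype.card V : ℝ) / ((Fintype.card V : ℝ) - 1) := by
  have hV : (2 : ℝ) ≤ Fintype.card V := by
    have : 2 ≤ Fintype.card V := by omega
    exact_mod_cast this
  have hone : 1 ≤ (Fintype.card V : ℝ) / ((Fintype.card V : ℝ) - 1) := by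
    rw [le_div_iff₀ (by linarith)]; linarith
  have hc : 0 ≤ c := by
    have : Nontrivial V := Fintype.one_lt_card_iff_nontrivial.1 (by omega)
    obtain ⟨i, j, hij⟩ := exists_pair_ne V
    exact (abs_nonneg _).trans_eq (hoff i j hij)
  have hge : ∀ i j, i ≠ j → -c ≤ g i j := fun i j hij => (abs_le.1 (hoff i j hij).le).1
  -- Edges mark the nonnegative correlations.
  let G : SimpleGraph V :=
    { Adj := fun i j => i ≠ j ∧ 0 ≤ g i j
      symm := ⟨fun i j h => ⟨h.1.symm, hsymm i j ▸ h.2⟩⟩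
      loopless := ⟨fun i h => h.1 rfl⟩ }
  obtain ⟨S, hS, hadj⟩ := exists_card_eq_forall_exists_adj_notMem G hKV
  obtain ⟨m, hmS, hbm⟩ := hb S hS
  have hsplit : ∑ k ∈ S, g k m = ∑ k ∈ S.erase m, g k m + 1 := by
    rw [← Finset.sum_erase_add S _ hmS, hdiag]
  rcases hadj m hmS with ⟨j, hjS, hjm⟩ | hiso
  -- Exchanging `m` for `j` makes `m` innocent; its sum loses the diagonal 1 and gains `g j m ≥ 0`,
  -- so `b - a ≤ 1`.
  · have hj : j ∉ S.erase m := fun h => hjS (Finset.mem_of_mem_erase h)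
    have h := ha (insert j (S.erase m))
      (by rw [Finset.card_insert_of_notMem hj, Finset.card_erase_of_mem hmS]; omega) m
      (by simp [hjm.1])
    rw [Finset.sum_insert hj] at h
    have : 0 ≤ g j m := hsymm m j ▸ hjm.2
    linarith
  · have hneg : ∀ {k l}, k ≠ l → ¬ G.Adj k l → g k l = -c := by
      intro k l hkl h
      have h0 : g k l < 0 := not_le.1 fun h' => h ⟨hkl, h'⟩
      rw [← hoff k l hkl, abs_of_neg h0, neg_neg]
    have hrow : ∑ k ∈ S, g k m = 1 - ((K : ℝ) - 1) * c := by
      have : ∑ k ∈ S.erase m, g k m = ∑ k ∈ S.erase m, -c := by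
        refine Finset.sum_congr rfl fun k hk => ?_
        rw [hsymm]
        exact hneg (Finset.ne_of_mem_erase hk).symm (hiso k)
      rw [hsplit, this, Finset.sum_const, Finset.card_erase_of_mem hmS, hS, nsmul_eq_mul,
        Nat.cast_sub hK, Nat.cast_one]
      ring
    -- Now `b ≤ 1 - (K - 1) c`. An edge `u v` anywhere gives `a ≥ c - (K - 1) c`, by framing `u`
    -- without `v`, hence `b - a ≤ 1 - c`.
    by_cases hex : ∃ u v, G.Adj u v
    · obtain ⟨u, v, huv⟩ := hex
      obtain ⟨T, huT, hTv, hT⟩ := Finset.exists_subsuperset_card_eq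
        (s := {u}) (t := Finset.univ.erase v) (n := K) (by simp [huv.1]) (by simpa using hK)
        (by rw [Finset.card_erase_of_mem (Finset.mem_univ v), Finset.card_univ]; omega)
      have huT : u ∈ T := huT (Finset.mem_singleton_self u)
      have hvT : v ∉ T := fun h => by simpa using hTv h
      have h := ha T hT v hvT
      rw [← Finset.sum_erase_add T _ huT, ← abs_of_nonneg huv.2, hoff u v huv.1] at h
      have h' : ∑ k ∈ T.erase u, -c ≤ ∑ k ∈ T.erase u, g k v :=
        Finset.sum_le_sum fun k hk => hge k v
          (fun hkv => hvT (hkv ▸ Finset.mem_of_mem_erase hk))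
      rw [Finset.sum_const, Finset.card_erase_of_mem huT, hT, nsmul_eq_mul,
        Nat.cast_sub hK, Nat.cast_one] at h'
      linarith
    -- Every off-diagonal entry is `-c`; nonnegativity of the total sum forces `c ≤ 1 / (|V| - 1)`,
    -- while `b - a ≤ 1 + c`.
    · push Not at hex
      have hsum : ∑ i, ∑ j, g i j
          = Fintype.card V * (1 - ((Fintype.card V : ℝ) - 1) * c) := by
        have : ∀ i, ∑ j, g i j = 1 - ((Fintype.card V : ℝ) - 1) * c := by
          intro i
          have h : ∑ j ∈ Finset.univ.erase i, g i j = ∑ j ∈ Finset.univ.erase i, -c :=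
            Finset.sum_congr rfl fun j hj => hneg (Finset.ne_of_mem_erase hj).symm (hex i j)
          rw [← Finset.sum_erase_add _ _ (Finset.mem_univ i), h, hdiag, Finset.sum_const,
            Finset.card_erase_of_mem (Finset.mem_univ i), Finset.card_univ, nsmul_eq_mul,
            Nat.cast_sub (by omega), Nat.cast_one]
          ring
        simp_rw [this, Finset.sum_const, Finset.card_univ, nsmul_eq_mul]
      rw [hsum] at hpos
      have hc' : 0 ≤ 1 - ((Fintype.card V : ℝ) - 1) * c :=
        nonneg_of_mul_nonneg_right hpos (by linarith)
      obtain ⟨v, hv⟩ : ∃ v, v ∉ S := by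
        by_contra! h
        have := Finset.card_eq_of_equiv_fin (s := S) (n := K)
          (Finset.equivFinOfCardEq hS)
        rw [Finset.eq_univ_of_forall h, Finset.card_univ] at this
        omega
      have h := ha S hS v hv
      have h' : ∑ k ∈ S, -c ≤ ∑ k ∈ S, g k v :=
        Finset.sum_le_sum fun k hk => hge k v (fun hkv => hv (hkv ▸ hk))
      rw [Finset.sum_const, hS, nsmul_eq_mul] at h'
      have : b - a ≤ 1 + c := by linarith
      refine this.trans ?_
      rw [le_div_iff₀ (by linarith)]
      linarith

end Combinatorics

/-! ### The Welch value of the coherence. -/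

section Frame

variable {N M : ℕ} {φ : Fin M → EuclideanSpace ℝ (Fin N)}

/-- The Welch value of the coherence of an equiangular tight frame. -/
lemma IsETF.sq_eq (h : IsETF φ) (hN : 0 < N) (hM : 1 < M) {c : ℝ}
    (hc : ∀ m n, m ≠ n → |inner ℝ (φ m) (φ n)| = c) :
    c ^ 2 = ((M : ℝ) - N) / (N * ((M : ℝ) - 1)) := by
  obtain ⟨A, hA⟩ := h.equal_norm_rows
  have hN' : (0 : ℝ) < N := by exact_mod_cast hN
  have hM' : (1 : ℝ) < M := by exact_mod_cast hM
  have hinner : ∀ m n, inner ℝ (φ m) (φ n) = ∑ i, φ m i * φ n i := by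
    intro m n
    simp [PiLp.inner_apply, mul_comm]
  have hself : ∀ m, ∑ i, φ m i * φ m i = 1 := by
    intro m
    rw [← hinner, real_inner_self_eq_norm_sq, h.unit_columns, one_pow]
  have hrow : ∀ i j, ∑ m, φ m i * φ m j = if i = j then A else 0 := by
    intro i j
    split_ifs with hij
    · subst hij
      rw [← hA i]
      exact Finset.sum_congr rfl fun m _ => (sq _).symm
    · exact h.orthogonal_rows i j hij
  -- The squared entries of the matrix, summed by rows and by columns, give `A = M / N`; the squared
  -- Frobenius norm of the Gram matrix, also computed in two ways, then determines `c ^ 2`.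
  have htrace : N * A = M := by
    have h1 : ∑ i : Fin N, ∑ m, φ m i * φ m i = N * A := by simp [hrow]
    rw [← h1, Finset.sum_comm]
    simp [hself]
  have hframe : ∑ m, ∑ n, inner ℝ (φ m) (φ n) ^ 2 = N * A ^ 2 := by
    calc ∑ m, ∑ n, inner ℝ (φ m) (φ n) ^ 2
        = ∑ m, ∑ n, ∑ i, ∑ j, (φ m i * φ m j) * (φ n i * φ n j) := by
          refine Finset.sum_congr rfl fun m _ => Finset.sum_congr rfl fun n _ => ?_
          rw [hinner, sq, Finset.sum_mul_sum]
          exact Finset.sum_congr rfl fun i _ => Finset.sum_congr rfl fun j _ => by ring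
      _ = ∑ i, ∑ j, (∑ m, φ m i * φ m j) * ∑ n, φ n i * φ n j := by
          simp_rw [Finset.sum_mul_sum]
          simp_rw [Finset.sum_comm (s := (Finset.univ : Finset (Fin M)))
            (t := (Finset.univ : Finset (Fin N)))]
      _ = N * A ^ 2 := by simp [hrow, sq]
  have hframe' : ∑ m, ∑ n, inner ℝ (φ m) (φ n) ^ 2 = M * (1 + ((M : ℝ) - 1) * c ^ 2) := by
    have : ∀ m, ∑ n, inner ℝ (φ m) (φ n) ^ 2 = 1 + ((M : ℝ) - 1) * c ^ 2 := by
      intro m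
      have h1 : ∑ n ∈ Finset.univ.erase m, inner ℝ (φ m) (φ n) ^ 2
          = ∑ n ∈ Finset.univ.erase m, c ^ 2 :=
        Finset.sum_congr rfl fun n hn => by
          rw [← sq_abs, hc m n (Finset.ne_of_mem_erase hn).symm]
      rw [← Finset.sum_erase_add _ _ (Finset.mem_univ m), h1, real_inner_self_eq_norm_sq,
        h.unit_columns, Finset.sum_const, Finset.card_erase_of_mem (Finset.mem_univ m),
        Finset.card_univ, Fintype.card_fin, nsmul_eq_mul, Nat.cast_sub hM.le, Nat.cast_one]
      ring
    simp_rw [this, Finset.sum_const, Finset.card_univ, Fintype.card_fin, nsmul_eq_mul]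
  have hkey : (M : ℝ) = N * (1 + ((M : ℝ) - 1) * c ^ 2) := by
    have h1 : (M : ℝ) * (1 + ((M : ℝ) - 1) * c ^ 2) = N * A ^ 2 := hframe' ▸ hframe
    have h2 : (M : ℝ) * M = M * (N * (1 + ((M : ℝ) - 1) * c ^ 2)) := by
      rw [← htrace] at h1 ⊢
      linear_combination (-(N : ℝ)) * h1
    exact mul_left_cancel₀ (by linarith) h2
  rw [eq_div_iff (by nlinarith)]
  linarith

end Frame

/-! ### Gaussian tails and one-dimensional projections of the noise. -/

section Gaussian

lemma Q_eq_measureReal_Ioi (x : ℝ) : Q x = (gaussianReal 0 1).real (Set.Ioi x) := by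
  rw [measureReal_def, gaussianReal_apply_eq_integral 0 one_ne_zero, ENNReal.toReal_ofReal
    (integral_nonneg fun _ => gaussianPDFReal_nonneg _ _ _), Q, gaussianPDFReal_def,
    integral_const_mul]
  simp

lemma Q_eq_measureReal_Ici (x : ℝ) : Q x = (gaussianReal 0 1).real (Set.Ici x) := by
  have := nullSingletonClass_gaussianReal (μ := 0) (one_ne_zero (α := NNReal))
  rw [Q_eq_measureReal_Ioi]
  exact measureReal_congr Ioi_ae_eq_Ici

lemma Q_eq_measureReal_Iio_neg (x : ℝ) : Q x = (gaussianReal 0 1).real (Set.Iio (-x)) := by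
  have h : (gaussianReal 0 1).map (fun y : ℝ => -y) = gaussianReal 0 1 := by
    rw [gaussianReal_map_neg, neg_zero]
  rw [Q_eq_measureReal_Ioi, ← h, map_measureReal_apply measurable_neg measurableSet_Iio, h]
  simp

lemma Q_antitone : Antitone Q := by
  intro x y hxy
  rw [Q_eq_measureReal_Ioi, Q_eq_measureReal_Ioi]
  exact measureReal_mono (Set.Ioi_subset_Ioi hxy)

lemma map_inner_noise {N : ℕ} {σ : ℝ} {u : EuclideanSpace ℝ (Fin N)} (hu : σ ^ 2 * ‖u‖ ^ 2 = 1) :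
    (noise N σ).map (fun ε => inner ℝ ε u) = gaussianReal 0 1 := by
  have : IsProbabilityMeasure (noise N σ) := by unfold noise; infer_instance
  have hmeas : Measurable fun ε : EuclideanSpace ℝ (Fin N) => inner ℝ ε u := by fun_prop
  have : IsProbabilityMeasure ((noise N σ).map (fun ε => inner ℝ ε u)) :=
    Measure.isProbabilityMeasure_map hmeas.aemeasurable
  have hS : (σ ^ 2 • (1 : Matrix (Fin N) (Fin N) ℝ)).PosSemidef :=
    Matrix.PosSemidef.one.smul (sq_nonneg σ)
  refine Measure.ext_of_charFun (funext fun t => ?_)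
  have h1 : charFun ((noise N σ).map (fun ε => inner ℝ ε u)) t = charFun (noise N σ) (t • u) := by
    rw [charFun_apply, charFun_apply, integral_map hmeas.aemeasurable (by fun_prop)]
    simp [inner_smul_right, mul_comm]
  have h2 : (t • u).ofLp ⬝ᵥ (σ ^ 2 • (1 : Matrix (Fin N) (Fin N) ℝ)).mulVec (t • u).ofLp
      = t ^ 2 := by
    have h3 : u.ofLp ⬝ᵥ u.ofLp = ‖u‖ ^ 2 := by
      rw [← real_inner_self_eq_norm_sq, PiLp.inner_apply]
      simp [dotProduct, sq]
    rw [Matrix.smul_mulVec, Matrix.one_mulVec]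
    simp only [WithLp.ofLp_smul, dotProduct_smul, smul_dotProduct, smul_eq_mul, h3]
    linear_combination t ^ 2 * hu
  rw [h1, noise, charFun_multivariateGaussian hS, h2, charFun_gaussianReal]
  simp

end Gaussian

/-! ### Error probabilities in terms of mean statistics. -/

section ErrorProbabilities

variable {N M : ℕ} {f : Fin M → EuclideanSpace ℝ (Fin N)} {σ γ : ℝ}

/-- The expected test statistic of user `m` when the coalition is `S`. -/
noncomputable def meanStat (f : Fin M → EuclideanSpace ℝ (Fin N)) (α : Fin M → ℝ)
    (S : Finset (Fin M)) (m : Fin M) : ℝ :=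
  testStat f m (forgery f S α 0)

lemma testStat_forgery (hγ : 0 < γ) (hσ : 0 < σ) {m : Fin M} (hf : ‖f m‖ = γ)
    (S : Finset (Fin M)) (α : Fin M → ℝ) (ε : EuclideanSpace ℝ (Fin N)) :
    testStat f m (forgery f S α ε)
      = meanStat f α S m + inner ℝ ε ((σ * γ)⁻¹ • f m) / (γ / σ) := by
  simp only [meanStat, testStat, forgery, add_zero, inner_add_left, inner_smul_right, hf]
  field_simp

lemma sq_mul_norm_inv_smul_sq (hγ : 0 < γ) (hσ : 0 < σ) {m : Fin M} (hf : ‖f m‖ = γ) :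
    σ ^ 2 * ‖(σ * γ)⁻¹ • f m‖ ^ 2 = 1 := by
  rw [norm_smul, hf, Real.norm_of_nonneg (by positivity)]
  field_simp

lemma probI_eq (hγ : 0 < γ) (hσ : 0 < σ) {m : Fin M} (hf : ‖f m‖ = γ)
    (τ : ℝ) (S : Finset (Fin M)) (α : Fin M → ℝ) :
    probI f σ m τ S α = Q ((τ - meanStat f α S m) * (γ / σ)) := by
  rw [probI, Q_eq_measureReal_Ici, ← map_inner_noise (sq_mul_norm_inv_smul_sq hγ hσ hf),
    map_measureReal_apply (by fun_prop) measurableSet_Ici]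
  congr 1
  ext ε
  simp only [Set.mem_ofPred_eq, Set.mem_preimage, Set.mem_Ici, testStat_forgery hγ hσ hf]
  rw [← le_div_iff₀ (by positivity), sub_le_iff_le_add']

lemma probII_eq (hγ : 0 < γ) (hσ : 0 < σ) {m : Fin M} (hf : ‖f m‖ = γ)
    (τ : ℝ) (S : Finset (Fin M)) (α : Fin M → ℝ) :
    probII f σ m τ S α = Q ((meanStat f α S m - τ) * (γ / σ)) := by
  rw [probII, Q_eq_measureReal_Iio_neg, ← neg_mul, neg_sub,
    ← map_inner_noise (sq_mul_norm_inv_smul_sq hγ hσ hf),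
    map_measureReal_apply (by fun_prop) measurableSet_Iio]
  congr 1
  ext ε
  simp only [Set.mem_ofPred_eq, Set.mem_preimage, Set.mem_Iio, testStat_forgery hγ hσ hf]
  rw [← div_lt_iff₀ (by positivity), lt_sub_iff_add_lt']

lemma exists_isGreatest_meanStat_innocent {K : ℕ} (hKM : K < M) (α : Fin M → ℝ) :
    ∃ a, IsGreatest {x | ∃ S : Finset (Fin M), S.card = K ∧ ∃ m, m ∉ S ∧ meanStat f α S m = x}
      a := by
  obtain ⟨S, hS⟩ : ∃ S : Finset (Fin M), S.card = K := by
    obtain ⟨S, -, hS⟩ := Finset.exists_subset_card_eq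
      (s := (Finset.univ : Finset (Fin M))) (n := K) (by simpa using hKM.le)
    exact ⟨S, hS⟩
  obtain ⟨m, hm⟩ : ∃ m, m ∉ S := by
    by_contra! h
    rw [Finset.eq_univ_of_forall h, Finset.card_univ, Fintype.card_fin] at hS
    omega
  have : Nonempty {p : Finset (Fin M) × Fin M // p.1.card = K ∧ p.2 ∉ p.1} := ⟨⟨(S, m), hS, hm⟩⟩
  obtain ⟨p, hp⟩ := Finite.exists_max
    fun p : {p : Finset (Fin M) × Fin M // p.1.card = K ∧ p.2 ∉ p.1} => meanStat f α p.1.1 p.1.2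
  refine ⟨_, ⟨p.1.1, p.2.1, p.1.2, p.2.2, rfl⟩, ?_⟩
  rintro _ ⟨T, hT, n, hn, rfl⟩
  exact hp ⟨(T, n), hT, hn⟩

/-- Since `Q` decreases, the easiest member to catch is the one with the largest mean, and the worst
coalition makes that mean smallest; `b` is this min-max value. -/
lemma exists_meanStat_guilty {K : ℕ} (hK : 1 ≤ K) (hKM : K < M) (α : Fin M → ℝ) :
    ∃ b, (∃ S : Finset (Fin M), S.card = K ∧ ∀ m ∈ S, meanStat f α S m ≤ b) ∧
      ∀ S : Finset (Fin M), S.card = K → ∃ m ∈ S, b ≤ meanStat f α S m := by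
  have hmax : ∀ S : {S : Finset (Fin M) // S.card = K},
      ∃ m ∈ S.1, ∀ n ∈ S.1, meanStat f α S.1 n ≤ meanStat f α S.1 m := fun S =>
    S.1.exists_max_image _ (Finset.card_pos.1 (by have := S.2; omega))
  choose m hm hmax using hmax
  obtain ⟨S, -, hS⟩ := Finset.exists_subset_card_eq
    (s := (Finset.univ : Finset (Fin M))) (n := K) (by simpa using hKM.le)
  have : Nonempty {S : Finset (Fin M) // S.card = K} := ⟨⟨S, hS⟩⟩
  obtain ⟨T, hT⟩ := Finite.exists_min
    fun S : {S : Finset (Fin M) // S.card = K} => meanStat f α S.1 (m S)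
  exact ⟨_, ⟨T.1, T.2, hmax T⟩, fun S hS => ⟨m ⟨S, hS⟩, hm ⟨S, hS⟩, hT ⟨S, hS⟩⟩⟩

lemma worstI_eq (hγ : 0 < γ) (hσ : 0 < σ) (hf : ∀ m, ‖f m‖ = γ) {K : ℕ} (hKM : K < M) {a : ℝ}
    (ha : IsGreatest {x | ∃ S : Finset (Fin M), S.card = K ∧
      ∃ m, m ∉ S ∧ meanStat f (uniformWeight M K) S m = x} a) (τ : ℝ) :
    worstI f σ K τ = Q ((τ - a) * (γ / σ)) := by
  obtain ⟨⟨S, hS, m, hm, rfl⟩, hmax⟩ := ha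
  have : Nonempty {S : Finset (Fin M) // S.card = K} := ⟨⟨S, hS⟩⟩
  refine le_antisymm (ciSup_le fun T => ?_) ?_
  · obtain ⟨n, hn⟩ : ∃ n, n ∉ T.1 := by
      by_contra! h
      have hT := T.2
      rw [Finset.eq_univ_of_forall h, Finset.card_univ, Fintype.card_fin] at hT
      omega
    have : Nonempty {n : Fin M // n ∉ T.1} := ⟨⟨n, hn⟩⟩
    refine ciSup_le fun n => ?_
    rw [probI_eq hγ hσ (hf n)]
    have := hmax ⟨T.1, T.2, n.1, n.2, rfl⟩
    exact Q_antitone (by gcongr)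
  · rw [← probI_eq hγ hσ (hf m)]
    exact (le_ciSup (f := fun n : {n : Fin M // n ∉ S} =>
      probI f σ n.1 τ S (uniformWeight M K)) (Set.finite_range _).bddAbove ⟨m, hm⟩).trans
      (le_ciSup (f := fun T : {T : Finset (Fin M) // T.card = K} =>
        probFalseAlarm f σ τ T.1 (uniformWeight M K)) (Set.finite_range _).bddAbove ⟨S, hS⟩)

lemma worstII_eq (hγ : 0 < γ) (hσ : 0 < σ) (hf : ∀ m, ‖f m‖ = γ) {K : ℕ} (hK : 1 ≤ K) {b : ℝ}
    (hb : ∃ S : Finset (Fin M), S.card = K ∧ ∀ m ∈ S, meanStat f (uniformWeight M K) S m ≤ b)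
    (hb' : ∀ S : Finset (Fin M), S.card = K →
      ∃ m ∈ S, b ≤ meanStat f (uniformWeight M K) S m) (τ : ℝ) :
    worstII f σ K τ = Q ((b - τ) * (γ / σ)) := by
  obtain ⟨S, hS, hmax⟩ := hb
  have : Nonempty {S : Finset (Fin M) // S.card = K} := ⟨⟨S, hS⟩⟩
  refine le_antisymm (ciSup_le fun T => ?_) ?_
  · obtain ⟨m, hm, hbm⟩ := hb' T.1 T.2
    refine (ciInf_le (f := fun n : {n : Fin M // n ∈ T.1} =>
      probII f σ n.1 τ T.1 (uniformWeight M K)) (Set.finite_range _).bddBelow ⟨m, hm⟩).trans ?_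
    rw [probII_eq hγ hσ (hf m)]
    exact Q_antitone (by gcongr)
  · refine le_trans ?_ (le_ciSup (f := fun T : {T : Finset (Fin M) // T.card = K} =>
      probMiss f σ τ T.1 (uniformWeight M K)) (Set.finite_range _).bddAbove ⟨S, hS⟩)
    obtain ⟨n, hn⟩ := Finset.card_pos.1 (show 0 < S.card by omega)
    have : Nonempty {n : Fin M // n ∈ S} := ⟨⟨n, hn⟩⟩
    refine le_ciInf fun n => ?_
    rw [probII_eq hγ hσ (hf n)]
    have := hmax n.1 n.2
    exact Q_antitone (by gcongr)

lemma meanStat_uniformWeight (hγ : 0 < γ) (hf : ∀ m, ‖f m‖ = γ) (K : ℕ) (S : Finset (Fin M))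
    (m : Fin M) :
    meanStat f (uniformWeight M K) S m
      = (∑ k ∈ S, inner ℝ ((‖f k‖)⁻¹ • f k) ((‖f m‖)⁻¹ • f m)) / K := by
  simp only [meanStat, testStat, forgery, uniformWeight, add_zero, sum_inner, inner_smul_left,
    inner_smul_right, hf, Finset.sum_div]
  refine Finset.sum_congr rfl fun k _ => ?_
  simp only [conj_trivial]
  field_simp

end ErrorProbabilities

/-! ### Optimal threshold and final estimates. -/

lemma coherence_eq {N M : ℕ} {f : Fin M → EuclideanSpace ℝ (Fin N)} (hM : 1 < M) {c : ℝ}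
    (hc : ∀ m n, m ≠ n → |inner ℝ ((‖f m‖)⁻¹ • f m) ((‖f n‖)⁻¹ • f n)| = c) :
    coherence f = c := by
  have : Nontrivial (Fin M) := Fin.nontrivial_iff_two_le.2 hM
  obtain ⟨i, j, hij⟩ := exists_pair_ne (Fin M)
  have : Nonempty {p : Fin M × Fin M // p.1 ≠ p.2} := ⟨⟨(i, j), hij⟩⟩
  have h : ∀ p : {p : Fin M × Fin M // p.1 ≠ p.2},
      |inner ℝ (f p.1.1) (f p.1.2)| / (‖f p.1.1‖ * ‖f p.1.2‖) = c := by
    intro p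
    rw [← hc _ _ p.2, inner_smul_left, inner_smul_right, abs_mul, abs_mul, conj_trivial,
      abs_of_nonneg (inv_nonneg.2 (norm_nonneg (f p.1.1))),
      abs_of_nonneg (inv_nonneg.2 (norm_nonneg (f p.1.2))), div_eq_mul_inv, mul_inv]
    ring
  simp [coherence, h]

/-- The maximum of the two tail probabilities is smallest at the midpoint. -/
lemma Q_midpoint_le_max (a b s τ : ℝ) (hs : 0 ≤ s) :
    Q ((b - a) / 2 * s) ≤ max (Q ((τ - a) * s)) (Q ((b - τ) * s)) := by
  rcases le_total τ ((a + b) / 2) with h | h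
  · exact le_max_of_le_left (Q_antitone (mul_le_mul_of_nonneg_right (by linarith) hs))
  · exact le_max_of_le_right (Q_antitone (mul_le_mul_of_nonneg_right (by linarith) hs))

/-- Weakens the combinatorial gap to the form of `dLow`; after squaring it amounts to `M (K - 1) ≤ K
(M - 1)`. -/
lemma div_le_sqrt_mul_inv_sqrt {M K : ℝ} (hK : 1 < K) (hKM : K < M) :
    M / (M - 1) / K ≤ Real.sqrt (M / (M - 1)) / Real.sqrt (K * (K - 1)) := by
  have hM : 0 < M - 1 := by linarith
  have hK0 : 0 < K - 1 := by linarith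
  rw [← Real.sqrt_div' _ (by positivity)]
  refine Real.le_sqrt_of_sq_le ?_
  rw [div_div, div_div, div_pow, div_le_div_iff₀ (by positivity) (by positivity)]
  have h : M * (K - 1) ≤ K * (M - 1) := by linarith
  calc M ^ 2 * ((M - 1) * (K * (K - 1))) = (M * (M - 1) * K) * (M * (K - 1)) := by ring
    _ ≤ (M * (M - 1) * K) * (K * (M - 1)) := by
        refine mul_le_mul_of_nonneg_left h ?_
        have : 0 < M := by linarith
        positivity
    _ = M * ((M - 1) * K) ^ 2 := by ring

end Fingerprint

theorem mainTheorem2 (N M K : ℕ) (hNM : N < M) (hK : 1 ≤ K) (hKM : K < M)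
    (Df σ : ℝ) (hDf : 0 < Df) (hσ : 0 < σ)
    (f : Fin M → EuclideanSpace ℝ (Fin N))
    (henergy : ∀ m, ‖f m‖ ^ 2 = (N : ℝ) * Df)
    (hETF : Fingerprint.IsETF (fun m => (‖f m‖)⁻¹ • f m)) :
    -- the coherence of the ETF has the Welch value
    Fingerprint.coherence f = Real.sqrt (((M : ℝ) - N) / (N * ((M : ℝ) - 1))) ∧
    -- the minimum over the threshold is attained
    IsLeast (Set.range (fun τ : ℝ => Fingerprint.worstError f σ K τ))
      (Fingerprint.minmaxError f σ K) ∧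
    -- lower bound
    (2 ≤ K → 2 * K ≤ M →
      Fingerprint.Q (Fingerprint.dLow N M K Df σ / 2) ≤ Fingerprint.minmaxError f σ K) ∧
    -- upper bound
    Fingerprint.minmaxError f σ K ≤
      Fingerprint.Q (Fingerprint.dUp N K Df σ (Fingerprint.coherence f) / 2) ∧
    -- the upper bound is achieved by the threshold `τ* = (1 + μ) / (2 K)`
    Fingerprint.worstError f σ K ((1 + Fingerprint.coherence f) / (2 * (K : ℝ))) ≤
      Fingerprint.Q (Fingerprint.dUp N K Df σ (Fingerprint.coherence f) / 2) := by
  open Fingerprint in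
  have hM : 1 < M := by omega
  have hK0 : (0 : ℝ) < K := by exact_mod_cast hK
  have hN : 0 < N := by
    -- For `N = 0` the fingerprints vanish, and so do their normalizations, which contradicts unit
    -- columns.
    rcases Nat.eq_zero_or_pos N with rfl | h
    · have hzero : ‖f ⟨0, by omega⟩‖ = 0 := by simpa using henergy ⟨0, by omega⟩
      have := hETF.unit_columns ⟨0, by omega⟩
      simp [hzero] at this
    · exact h
  set γ : ℝ := Real.sqrt ((N : ℝ) * Df) with hγdef
  have hN0 : (0 : ℝ) < N := by exact_mod_cast hN
  have hγ : 0 < γ := Real.sqrt_pos.2 (by positivity)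
  have hf : ∀ m, ‖f m‖ = γ := fun m => by
    rw [hγdef, ← henergy m, Real.sqrt_sq (norm_nonneg _)]
  obtain ⟨c, hc⟩ := hETF.equiangular
  have hcoh : coherence f = c := coherence_eq hM hc
  have hc0 : 0 ≤ c := (abs_nonneg _).trans_eq (hc ⟨0, by omega⟩ ⟨1, hM⟩ (by simp))
  set g : Fin M → Fin M → ℝ :=
    fun k m => inner ℝ ((‖f k‖)⁻¹ • f k) ((‖f m‖)⁻¹ • f m) with hg
  have hdiag : ∀ m, g m m = 1 := fun m => by
    rw [hg]
    simp only [real_inner_self_eq_norm_sq]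
    rw [hETF.unit_columns m, one_pow]
  have hmean : ∀ S m, meanStat f (uniformWeight M K) S m = (∑ k ∈ S, g k m) / K :=
    meanStat_uniformWeight hγ hf K
  obtain ⟨a, ha⟩ := exists_isGreatest_meanStat_innocent (f := f) hKM (uniformWeight M K)
  obtain ⟨b, hb, hb'⟩ := exists_meanStat_guilty (f := f) hK hKM (uniformWeight M K)
  have hs : 0 ≤ γ / σ := by positivity
  have herr : ∀ τ, worstError f σ K τ
      = max (Q ((τ - a) * (γ / σ))) (Q ((b - τ) * (γ / σ))) := fun τ => by
    rw [worstError, worstI_eq hγ hσ hf hKM ha, worstII_eq hγ hσ hf hK hb hb']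
  have hleast : IsLeast (Set.range fun τ : ℝ => worstError f σ K τ)
      (Q ((b - a) / 2 * (γ / σ))) := by
    refine ⟨⟨(a + b) / 2, ?_⟩, ?_⟩
    · have h1 : (a + b) / 2 - a = (b - a) / 2 := by ring
      have h2 : b - (a + b) / 2 = (b - a) / 2 := by ring
      simp only [herr, h1, h2, max_self]
    · rintro _ ⟨τ, rfl⟩
      simp only [herr]
      exact Q_midpoint_le_max a b _ τ hs
  have hmin : minmaxError f σ K = Q ((b - a) / 2 * (γ / σ)) := hleast.csInf_eq
  have hupper : worstError f σ K ((1 + c) / (2 * K)) ≤ Q (dUp N K Df σ c / 2) := by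
    have ha_le : a ≤ c := by
      obtain ⟨S, hS, m, hm, rfl⟩ := ha.1
      rw [hmean, div_le_iff₀ hK0]
      calc ∑ k ∈ S, g k m ≤ ∑ k ∈ S, c := Finset.sum_le_sum fun k hk =>
            (abs_le.1 (hc k m fun h => hm (h ▸ hk)).le).2
        _ = c * K := by rw [Finset.sum_const, hS, nsmul_eq_mul, mul_comm]
    have hb_ge : (1 - ((K : ℝ) - 1) * c) / K ≤ b := by
      obtain ⟨S, hS, hSb⟩ := hb
      obtain ⟨m, hm⟩ := Finset.card_pos.1 (show 0 < S.card by omega)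
      refine le_trans ?_ (hSb m hm)
      rw [hmean, ← Finset.sum_erase_add S _ hm, hdiag]
      have h : ∑ k ∈ S.erase m, -c ≤ ∑ k ∈ S.erase m, g k m :=
        Finset.sum_le_sum fun k hk => (abs_le.1 (hc k m (Finset.ne_of_mem_erase hk)).le).1
      rw [Finset.sum_const, Finset.card_erase_of_mem hm, hS, nsmul_eq_mul, Nat.cast_sub hK,
        Nat.cast_one] at h
      gcongr
      linarith
    have hd : dUp N K Df σ c / 2 = (1 - (2 * K - 1) * c) / (2 * K) * (γ / σ) := by
      rw [dUp, ← hγdef]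
      field_simp
    -- The threshold `(1 + c) / (2 K)` is the midpoint of the bounds `a ≤ c` and `(1 - (K - 1) c) /
    -- K ≤ b`.
    rw [herr, hd]
    refine max_le (Q_antitone (mul_le_mul_of_nonneg_right ?_ hs))
      (Q_antitone (mul_le_mul_of_nonneg_right ?_ hs))
    · have : (1 - (2 * K - 1) * c) / (2 * K) = (1 + c) / (2 * K) - c := by field_simp; ring
      linarith
    · have : (1 - (2 * K - 1) * c) / (2 * K)
          = (1 - ((K : ℝ) - 1) * c) / K - (1 + c) / (2 * K) := by field_simp; ring
      linarith
  rw [hcoh, hmin]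
  refine ⟨?_, hleast, fun hK2 hKM2 => ?_, (hleast.2 ⟨_, rfl⟩).trans hupper, hupper⟩
  · rw [← hETF.sq_eq hN hM hc, Real.sqrt_sq hc0]
  -- The total Gram sum is the squared norm of the sum of the frame vectors.
  · have hpos : 0 ≤ ∑ i, ∑ j, g i j := by
      have h : ∑ i, ∑ j, g i j
          = inner ℝ (∑ i, (‖f i‖)⁻¹ • f i) (∑ j, (‖f j‖)⁻¹ • f j) := by
        simp only [hg, sum_inner, inner_sum]
        exact Finset.sum_comm
      rw [h]
      exact real_inner_self_nonneg
    have hgap := guilty_sub_innocent_le (g := g) (c := c) (a := a * K) (b := b * K) (K := K)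
      (fun i j => real_inner_comm _ _) hdiag hc hpos hK (by simpa using hKM2)
      (fun S hS m hm => by
        rw [← div_le_iff₀ hK0, ← hmean]
        exact ha.2 ⟨S, hS, m, hm, rfl⟩)
      (fun S hS => by
        obtain ⟨m, hm, h⟩ := hb' S hS
        rw [hmean, le_div_iff₀ hK0] at h
        exact ⟨m, hm, h⟩)
    rw [Fintype.card_fin, ← sub_mul, ← le_div_iff₀ hK0] at hgap
    have hgap' := hgap.trans (div_le_sqrt_mul_inv_sqrt
      (M := M) (K := K) (by exact_mod_cast hK2) (by exact_mod_cast hKM))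
    refine Q_antitone ?_
    have hd : dLow N M K Df σ / 2 = Real.sqrt ((M : ℝ) / ((M : ℝ) - 1)) /
        Real.sqrt ((K : ℝ) * ((K : ℝ) - 1)) / 2 * (γ / σ) := by
      rw [dLow, ← hγdef]
      ring
    rw [hd]
    exact mul_le_mul_of_nonneg_right (by linarith) hs
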